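/- **Theorem (atomizing embedding).** Consider System F ($\mathsf{\Lambda 2}$) in Church style, with types $A,B ::= X \mid A\Rightarrow B\mid \forall X.A$ and terms $t,u ::= x\mid \lambda x^{A}.t\mid tu\mid \Lambda X.t\mid tB$. *The systems.* A polynomial type is here a type $P[X]=\langle\langle A_{jk}\rangle_{j}\Rightarrow X\rangle_{k}\Rightarrow X$ (finite, possibly empty, lists of indices $j,k$; $\langle C_i\rangle_{i}\Rightarrow D$ abbreviates $C_{1}\Rightarrow\dots\Rightarrow C_{n}\Rightarrow D$) such that $X$ does not occur free in any $A_{jk}$. $\mathsf{\Lambda 2^{Poly}}$ is the fragment of $\mathsf{\Lambda 2}$ whose types are those in which every universal type that occurs is of the form $\forall X.P[X]$ with $P[X]$ polynomial; it has the typing rules of $\mathsf{\Lambda 2}$, all types in a derivation being types of the fragment. $\mathsf{\Lambda 2_{at}}$ is the subsystem of $\mathsf{\Lambda 2}$ with all the types of $\mathsf{\Lambda 2}$ in which a term $t:\forall X.A$ may be instantiated only at type variables. *The $\varepsilon$-theory.* For a type $A$ in which all occurrences of $X$ are positive (or all are negative) and a term $v[x]$ with distinguished variable $x$, let $\Phi_X(v)=v$,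 $\Phi_Y(v)=x$ for $Y\neq X$, $\Phi_{C\Rightarrow D}(v)=\lambda y.\Phi_D(v)[x\mapsto x\,(\Phi_C(v)[x\mapsto y])]$, $\Phi_{\forall Y.C}(v)=\Lambda Y.\Phi_C(v)[x\mapsto xY]$. The $\varepsilon$-theory $\simeq_\varepsilon$ is the smallest congruence on well-typed terms (equations $\Gamma\vdash t\simeq u:A$) that contains the $\beta$- and $\eta$-equations for $\Rightarrow$ and $\forall$ and is closed under the following two rules. Let $v$ satisfy $\Gamma,x:E\vdash v:F$. (a) Let $\Gamma\vdash t:\forall X.\langle\forall\vec Y_k.\langle A_{jk}\rangle_j\Rightarrow X\rangle_k\Rightarrow B$ with all occurrences of $X$ in $A_{jk}$ and in $B$ positive, $\Gamma\vdash e_k:\forall\vec Y_k.\langle A_{jk}[E/X]\rangle_j\Rightarrow E$ and $\Gamma\vdash f_k:\forall\vec Y_k.\langle A_{jk}[F/X]\rangle_j\Rightarrow F$. If for every $k$, in the context $\Gamma,\langle z_j:A_{jk}[E/X]\rangle_j$, $v[e_k\vec Y_k\langle z_j\rangle_j]\simeq f_k\vec Y_k\langle\Phi_{A_{jk}}(v)[z_j]\rangle_j: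 F$, then $\Gamma\vdash\Phi_B(v)[tE\langle e_k\rangle_k]\simeq tF\langle f_k\rangle_k:B[F/X]$. (b) Let $\Gamma\vdash t:\forall X.\langle\forall\vec Y_j.X\Rightarrow A_j\rangle_j\Rightarrow B$ with all occurrences of $X$ in $A_j$ positive and all those in $B$ negative, $\Gamma\vdash e_j:\forall\vec Y_j.E\Rightarrow A_j[E/X]$ and $\Gamma\vdash f_j:\forall\vec Y_j.F\Rightarrow A_j[F/X]$. If for every $j$, $\Gamma,x:E\vdash\Phi_{A_j}(v)[e_j\vec Y_jx]\simeq f_j\vec Y_j\,v[x]:A_j[F/X]$, then $\Gamma\vdash\Phi_B(v)[tF\langle f_j\rangle_j]\simeq tE\langle e_j\rangle_j:B[E/X]$. *Statement.* If $\Gamma\vdash_{\mathsf{\Lambda 2^{Poly}}}t:A$, then there is a term $t^{\downarrow}$ such that $\Gamma\vdash_{\mathsf{\Lambda 2_{at}}}t^{\downarrow}:A$ and $\Gamma\vdash t\simeq_{\varepsilon}t^{\downarrow}:A$. The equation holds already in the $\varepsilon$-theory of $\mathsf{\Lambda 2^{Poly}}$, that is, in the theory generated as above with all types taken from this fragment,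 and hence in that of every larger fragment of $\mathsf{\Lambda 2}$. -/

import Mathlib

/-! System F in the style of Church, with de Bruijn indices both for type variables and for term
variables: the term `t` below `lam A t` (resp. `tlam t`) has one more term (resp. type) variable,
of index `0`. -/

namespace SystemF

/-- Types: variables, `A ⇒ B`, `∀X.A`. -/
inductive Ty : Type
  | var : ℕ → Ty
  | arrow : Ty → Ty → Ty
  | all : Ty → Ty

/-- Terms: variables, `λ(x : A).t`, `t u`, `ΛX.t`, `t B`. -/
inductive Tm : Type
  | var : ℕ → Tm
  | lam : Ty → Tm → Tm
  | app : Tm → Tm → Tm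
  | tlam : Tm → Tm
  | tapp : Tm → Ty → Tm

/-- A renaming, pushed under one binder. -/
def upr (ξ : ℕ → ℕ) : ℕ → ℕ
  | 0 => 0
  | n + 1 => ξ n + 1

/-! ### Renaming and substitution of types -/

def Ty.ren : (ℕ → ℕ) → Ty → Ty
  | ξ, .var i => .var (ξ i)
  | ξ, .arrow A B => .arrow (A.ren ξ) (B.ren ξ)
  | ξ, .all A => .all (A.ren (upr ξ))

/-- `A`, seen as a type with one more type variable, which does not occur in it. -/
def Ty.lift (A : Ty) : Ty := A.ren Nat.succ

/-- A type substitution, pushed under one type binder. -/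
def Ty.up (σ : ℕ → Ty) : ℕ → Ty
  | 0 => .var 0
  | n + 1 => (σ n).lift

def Ty.subst : (ℕ → Ty) → Ty → Ty
  | σ, .var i => σ i
  | σ, .arrow A B => .arrow (A.subst σ) (B.subst σ)
  | σ, .all A => .all (A.subst (Ty.up σ))

/-- The substitution of `B` for the type variable `0`. -/
def Ty.one (B : Ty) : ℕ → Ty
  | 0 => B
  | n + 1 => .var n

/-- `A[B/X]`, for `X` the type variable `0`. -/
def Ty.inst (A B : Ty) : Ty := A.subst (Ty.one B)

/-- The substitution of `B` for the type variable `n`, below `n` type binders. -/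
def Ty.oneAt (n : ℕ) (B : Ty) : ℕ → Ty := Ty.up^[n] (Ty.one B)

/-! ### Renaming and substitution of terms -/

/-- Renaming of type variables in a term. -/
def Tm.tren : (ℕ → ℕ) → Tm → Tm
  | _, .var i => .var i
  | ξ, .lam A t => .lam (A.ren ξ) (t.tren ξ)
  | ξ, .app t u => .app (t.tren ξ) (u.tren ξ)
  | ξ, .tlam t => .tlam (t.tren (upr ξ))
  | ξ, .tapp t B => .tapp (t.tren ξ) (B.ren ξ)

/-- Renaming of term variables in a term. -/
def Tm.ren : (ℕ → ℕ) → Tm → Tm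
  | ξ, .var i => .var (ξ i)
  | ξ, .lam A t => .lam A (t.ren (upr ξ))
  | ξ, .app t u => .app (t.ren ξ) (u.ren ξ)
  | ξ, .tlam t => .tlam (t.ren ξ)
  | ξ, .tapp t B => .tapp (t.ren ξ) B

/-- Substitution of types for type variables in a term. -/
def Tm.tsubst : (ℕ → Ty) → Tm → Tm
  | _, .var i => .var i
  | σ, .lam A t => .lam (A.subst σ) (t.tsubst σ)
  | σ, .app t u => .app (t.tsubst σ) (u.tsubst σ)
  | σ, .tlam t => .tlam (t.tsubst (Ty.up σ))
  | σ, .tapp t B => .tapp (t.tsubst σ) (B.subst σ)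

/-- A term substitution, pushed under one term binder. -/
def Tm.up (τ : ℕ → Tm) : ℕ → Tm
  | 0 => .var 0
  | n + 1 => (τ n).ren Nat.succ

/-- Substitution of terms for term variables in a term. -/
def Tm.subst : (ℕ → Tm) → Tm → Tm
  | τ, .var i => τ i
  | τ, .lam A t => .lam A (t.subst (Tm.up τ))
  | τ, .app t u => .app (t.subst τ) (u.subst τ)
  | τ, .tlam t => .tlam (t.subst fun i => (τ i).tren Nat.succ)
  | τ, .tapp t B => .tapp (t.subst τ) B

/-- The substitution of `u` for the term variable `0`. -/
def Tm.one (u : Tm) : ℕ → Tm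
  | 0 => u
  | n + 1 => .var n

/-- `t[u/x]`, for `x` the term variable `0`. -/
def Tm.inst (t u : Tm) : Tm := t.subst (Tm.one u)

/-- `t[B/X]`, for `X` the type variable `0`. -/
def Tm.tinst (t : Tm) (B : Ty) : Tm := t.tsubst (Ty.one B)

/-! ### Lists of arguments -/

/-- `⟨A₁, …, Aₖ⟩ ⇒ B`. -/
def arrows (As : List Ty) (B : Ty) : Ty := As.foldr Ty.arrow B

/-- `∀Y₁ … Yₙ. A`. -/
def alls (n : ℕ) (A : Ty) : Ty := Ty.all^[n] A

/-- `t u₁ … uₖ`. -/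
def apps (t : Tm) (us : List Tm) : Tm := us.foldl Tm.app t

/-- The last `n` type variables introduced, in the order of their introduction. -/
def tyVars (n : ℕ) : List Ty := (List.range n).reverse.map Ty.var

/-- The last `m` term variables introduced, in the order of their introduction. -/
def tmVars (m : ℕ) : List Tm := (List.range m).reverse.map Tm.var

/-- `t Y₁ … Yₙ`, for the last `n` type variables introduced. -/
def tappVars (t : Tm) (n : ℕ) : Tm := (tyVars n).foldl Tm.tapp t

/-! ### Typing -/

/-- The judgement `Γ ⊢ t : A` in the subsystem of System F in which all types that occur in
contexts, terms and typing derivations belong to `S`, and all type instantiations `t B` have in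
addition `I B`. The head of the list `Γ` is the type of the term variable `0`. -/
inductive HasType (S I : Ty → Prop) : List Ty → Tm → Ty → Prop
  | var {Γ : List Ty} {i : ℕ} {A : Ty} :
      (∀ B ∈ Γ, S B) → Γ[i]? = some A → HasType S I Γ (.var i) A
  | lam {Γ : List Ty} {A B : Ty} {t : Tm} :
      S (.arrow A B) → HasType S I (A :: Γ) t B → HasType S I Γ (.lam A t) (.arrow A B)
  | app {Γ : List Ty} {A B : Ty} {t u : Tm} :
      S B → HasType S I Γ t (.arrow A B) → HasType S I Γ u A → HasType S I Γ (.app t u) B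
  | tlam {Γ : List Ty} {A : Ty} {t : Tm} :
      S (.all A) → HasType S I (Γ.map Ty.lift) t A → HasType S I Γ (.tlam t) (.all A)
  | tapp {Γ : List Ty} {A B : Ty} {t : Tm} :
      S B → I B → S (A.inst B) → HasType S I Γ t (.all A) →
      HasType S I Γ (.tapp t B) (A.inst B)

/-! ### The functorial action of a type -/

/-- `Occ true i A` (resp. `Occ false i A`): all occurrences of the type variable `i` in `A` are
positive (resp. negative). -/
def Ty.Occ : Bool → ℕ → Ty → Prop
  | pos, i, .var j => j = i → pos = true
  | pos, i, .arrow A B => A.Occ (!pos) i ∧ B.Occ pos i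
  | pos, i, .all A => A.Occ pos (i + 1)

/-- Let `v` be a term with a distinguished variable `x`, the term variable `0`. For `X` the type
variable `i`, `act A i P Q v s` is the term `Φ_A(v)[x ↦ s]`, where
`Φ_X(v) = v`, `Φ_Y(v) = x`, `Φ_{C ⇒ D}(v) = λy. Φ_D(v)[x ↦ x (Φ_C(v)[x ↦ y])]` and
`Φ_{∀Y.C}(v) = ΛY. Φ_C(v)[x ↦ x Y]`. It maps `A.subst P` to `A.subst Q`, where, for
`v[x] : E ⊢ F`, the substitutions `P` and `Q` are `X ↦ E` and `X ↦ F` if `X` is only positive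
in `A`, and `X ↦ F` and `X ↦ E` if `X` is only negative in `A`; they only serve to annotate the
abstractions. -/
def act : Ty → ℕ → (ℕ → Ty) → (ℕ → Ty) → Tm → Tm → Tm
  | .var j, i, _, _, v, s => if j = i then v.inst s else s
  | .arrow C D, i, P, Q, v, s =>
      .lam (C.subst Q)
        (act D i P Q (v.ren (upr Nat.succ))
          (.app (s.ren Nat.succ) (act C i Q P (v.ren (upr Nat.succ)) (.var 0))))
  | .all C, i, P, Q, v, s =>
      .tlam (act C (i + 1) (Ty.up P) (Ty.up Q) (v.tren Nat.succ)
        (.tapp (s.tren Nat.succ) (.var 0)))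

/-! ### The epsilon-theory -/

/-- An argument type `∀Y₁ … Yₙ. ⟨A₁, …, Aₘ⟩ ⇒ X`, with a term `src` of this type for `X = E` and a
term `tgt` of this type for `X = F`. The types `Aⱼ` live below the binders of `X, Y₁, …, Yₙ`, so
that `X` is their variable `n`. -/
structure AlgArg where
  n : ℕ
  dom : List Ty
  src : Tm
  tgt : Tm

/-- An argument type `∀Y₁ … Yₙ. X ⇒ A`, with terms of this type for `X = E` and `X = F`. -/
structure CoalgArg where
  n : ℕ
  cod : Ty
  src : Tm
  tgt : Tm

def AlgArg.ty (d : AlgArg) : Ty := alls d.n (arrows d.dom (.var d.n))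

def CoalgArg.ty (d : CoalgArg) : Ty := alls d.n (.arrow (.var d.n) d.cod)

/-- `weaken n m t`: the term `t` in the context extended by `n` type variables and `m` term
variables. -/
def weaken (n m : ℕ) (t : Tm) : Tm := (t.tren (· + n)).ren (· + m)

/-- The same for a term `v[x]`, whose distinguished variable `x` remains the variable `0`. -/
def weakenBody (n m : ℕ) (v : Tm) : Tm := (v.tren (· + n)).ren (upr (· + m))

/-- The equations `Γ ⊢ t ≃ u : A` of the epsilon-theory of the fragment of System F with types in
`S`: the smallest congruence on well-typed terms that contains the `β`- and `η`-equations and is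
closed under the two `ε`-rules, which express strong dinaturality for the universal types
`∀X. ⟨∀Y⃗ₖ. ⟨Aⱼₖ⟩ⱼ ⇒ X⟩ₖ ⇒ B` (with `X` only positive in `Aⱼₖ` and `B`) and
`∀X. ⟨∀Y⃗ⱼ. X ⇒ Aⱼ⟩ⱼ ⇒ B` (with `X` only positive in `Aⱼ` and only negative in `B`). -/
inductive EpsEq (S : Ty → Prop) : List Ty → Tm → Tm → Ty → Prop
  | refl {Γ : List Ty} {t : Tm} {A : Ty} :
      HasType S (fun _ => True) Γ t A → EpsEq S Γ t t A
  | symm {Γ : List Ty} {t u : Tm} {A : Ty} : EpsEq S Γ t u A → EpsEq S Γ u t A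
  | trans {Γ : List Ty} {t u w : Tm} {A : Ty} :
      EpsEq S Γ t u A → EpsEq S Γ u w A → EpsEq S Γ t w A
  | lam {Γ : List Ty} {A B : Ty} {t u : Tm} :
      S (.arrow A B) → EpsEq S (A :: Γ) t u B → EpsEq S Γ (.lam A t) (.lam A u) (.arrow A B)
  | app {Γ : List Ty} {A B : Ty} {t t' u u' : Tm} :
      S B → EpsEq S Γ t t' (.arrow A B) → EpsEq S Γ u u' A →
      EpsEq S Γ (.app t u) (.app t' u') B
  | tlam {Γ : List Ty} {A : Ty} {t u : Tm} :
      S (.all A) → EpsEq S (Γ.map Ty.lift) t u A → EpsEq S Γ (.tlam t) (.tlam u) (.all A)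
  | tapp {Γ : List Ty} {A B : Ty} {t u : Tm} :
      S B → S (A.inst B) → EpsEq S Γ t u (.all A) →
      EpsEq S Γ (.tapp t B) (.tapp u B) (A.inst B)
  | beta {Γ : List Ty} {A B : Ty} {t u : Tm} :
      S (.arrow A B) → HasType S (fun _ => True) (A :: Γ) t B →
      HasType S (fun _ => True) Γ u A →
      EpsEq S Γ (.app (.lam A t) u) (t.inst u) B
  | tbeta {Γ : List Ty} {A B : Ty} {t : Tm} :
      S (.all A) → S B → S (A.inst B) → HasType S (fun _ => True) (Γ.map Ty.lift) t A →
      EpsEq S Γ (.tapp (.tlam t) B) (t.tinst B) (A.inst B)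
  | eta {Γ : List Ty} {A B : Ty} {t : Tm} :
      HasType S (fun _ => True) Γ t (.arrow A B) →
      EpsEq S Γ t (.lam A (.app (t.ren Nat.succ) (.var 0))) (.arrow A B)
  | teta {Γ : List Ty} {A : Ty} {t : Tm} :
      HasType S (fun _ => True) Γ t (.all A) →
      EpsEq S Γ t (.tlam (.tapp (t.tren Nat.succ) (.var 0))) (.all A)
  | eps_pos {Γ : List Ty} {E F B : Ty} {t v : Tm} {D : List AlgArg} :
      S E → S F →
      B.Occ true 0 → (∀ d ∈ D, ∀ A ∈ d.dom, A.Occ true d.n) →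
      HasType S (fun _ => True) Γ t (.all (arrows (D.map AlgArg.ty) B)) →
      (∀ d ∈ D, HasType S (fun _ => True) Γ d.src (d.ty.inst E)) →
      (∀ d ∈ D, HasType S (fun _ => True) Γ d.tgt (d.ty.inst F)) →
      HasType S (fun _ => True) (E :: Γ) v F →
      -- `Γ, Y⃗, z⃗ : ⟨Aⱼ[E]⟩ⱼ ⊢ v[src Y⃗ z⃗] ≃ tgt Y⃗ ⟨Φ_{Aⱼ}(v)[zⱼ]⟩ⱼ : F`
      (∀ d ∈ D, EpsEq S
        ((d.dom.map (Ty.subst (Ty.oneAt d.n E))).reverse ++ Γ.map (Ty.ren (· + d.n)))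
        ((weakenBody d.n d.dom.length v).inst
          (apps (tappVars (weaken d.n d.dom.length d.src) d.n) (tmVars d.dom.length)))
        (apps (tappVars (weaken d.n d.dom.length d.tgt) d.n)
          (List.zipWith
            (fun A z => act A d.n (Ty.oneAt d.n E) (Ty.oneAt d.n F)
              (weakenBody d.n d.dom.length v) z)
            d.dom (tmVars d.dom.length)))
        (F.ren (· + d.n))) →
      EpsEq S Γ
        (act B 0 (Ty.one E) (Ty.one F) v (apps (.tapp t E) (D.map AlgArg.src)))
        (apps (.tapp t F) (D.map AlgArg.tgt))
        (B.inst F)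
  | eps_neg {Γ : List Ty} {E F B : Ty} {t v : Tm} {D : List CoalgArg} :
      S E → S F →
      B.Occ false 0 → (∀ d ∈ D, d.cod.Occ true d.n) →
      HasType S (fun _ => True) Γ t (.all (arrows (D.map CoalgArg.ty) B)) →
      (∀ d ∈ D, HasType S (fun _ => True) Γ d.src (d.ty.inst E)) →
      (∀ d ∈ D, HasType S (fun _ => True) Γ d.tgt (d.ty.inst F)) →
      HasType S (fun _ => True) (E :: Γ) v F →
      -- `Γ, Y⃗, x : E ⊢ Φ_{A}(v)[src Y⃗ x] ≃ tgt Y⃗ (v[x]) : A[F]`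
      (∀ d ∈ D, EpsEq S
        (E.ren (· + d.n) :: Γ.map (Ty.ren (· + d.n)))
        (act d.cod d.n (Ty.oneAt d.n E) (Ty.oneAt d.n F) (weakenBody d.n 1 v)
          (.app (tappVars (weaken d.n 1 d.src) d.n) (.var 0)))
        (.app (tappVars (weaken d.n 1 d.tgt) d.n) ((weakenBody d.n 1 v).inst (.var 0)))
        (d.cod.subst (Ty.oneAt d.n F))) →
      EpsEq S Γ
        (act B 0 (Ty.one F) (Ty.one E) v (apps (.tapp t F) (D.map CoalgArg.tgt)))
        (apps (.tapp t E) (D.map CoalgArg.src))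
        (B.inst E)

/-! ### The polynomial fragment and the atomic system -/

/-- The polynomial type `P[X] = ⟨⟨Aⱼₖ⟩ⱼ ⇒ X⟩ₖ ⇒ X` in which `X` (the variable `0`) does not occur
in the types `Aⱼₖ`. -/
def polynomial (K : List (List Ty)) : Ty :=
  arrows (K.map fun As => arrows (As.map Ty.lift) (.var 0)) (.var 0)

/-- The types of the polynomial fragment: each universal type that occurs in them is of the form
`∀X.P[X]` for a polynomial type `P[X]` as above. -/
inductive Ty.Poly : Ty → Prop
  | var (i : ℕ) : Ty.Poly (.var i)
  | arrow {A B : Ty} : Ty.Poly A → Ty.Poly B → Ty.Poly (.arrow A B)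
  | all {K : List (List Ty)} :
      (∀ As ∈ K, ∀ A ∈ As, Ty.Poly A) → Ty.Poly (.all (polynomial K))

/-- Typing in the polynomial fragment: all types are types of the fragment. -/
def PolyTyped (Γ : List Ty) (t : Tm) (A : Ty) : Prop :=
  HasType Ty.Poly (fun _ => True) Γ t A

/-- Typing in the atomic system: all types of System F are allowed, but a term may only be
instantiated at a type variable. -/
def AtTyped (Γ : List Ty) (t : Tm) (A : Ty) : Prop :=
  HasType (fun _ => True) (fun B => ∃ i, B = .var i) Γ t A

end SystemF

/-! An instance `t B` of a polynomial type `∀X.P[X]` is first `η`-expanded over the arguments of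
`P[B]`, so that it suffices to atomize `t B ⟨eₖ⟩ₖ`. This is done by recursion on `B`. If
`B = C ⇒ D`, expand to `λy. t B ⟨eₖ⟩ₖ y`: the first `ε`-rule, for the term `v[x] = x y`, turns the
body into `t D ⟨fₖ⟩ₖ` with `fₖ = λz⃗. v[eₖ z⃗]`. If `B = ∀Y.D`, do the same with `ΛY` and
`v[x] = x Y`. At a type variable the instance is atomic. The `fₖ` satisfy the premises of the
`ε`-rule because `X` does not occur in the types `Aⱼₖ`, whose functorial action is then a mere
`η`-expansion. -/

namespace SystemF

/-! ### Renaming and substitution -/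

theorem upr_id : upr id = id := by
  funext i; cases i <;> rfl

theorem upr_comp_upr (ξ ζ : ℕ → ℕ) : upr ξ ∘ upr ζ = upr (ξ ∘ ζ) := by
  funext i; cases i <;> rfl

namespace Ty

theorem ren_id (A : Ty) : A.ren id = A := by
  induction A with
  | var i => rfl
  | arrow A B ihA ihB => simp only [ren, ihA, ihB]
  | all A ih => simp only [ren, upr_id, ih]

theorem ren_ren (A : Ty) (ξ ζ : ℕ → ℕ) : (A.ren ζ).ren ξ = A.ren (ξ ∘ ζ) := by
  induction A generalizing ξ ζ with
  | var i => rfl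
  | arrow A B ihA ihB => simp only [ren, ihA, ihB]
  | all A ih => simp only [ren, ih, upr_comp_upr]

theorem lift_ren_upr (A : Ty) (ξ : ℕ → ℕ) : A.lift.ren (upr ξ) = (A.ren ξ).lift := by
  simp only [lift, ren_ren]; rfl

theorem up_comp_upr (σ : ℕ → Ty) (ξ : ℕ → ℕ) : up σ ∘ upr ξ = up (σ ∘ ξ) := by
  funext i; cases i <;> rfl

theorem up_var : up var = var := by
  funext i; cases i <;> rfl

theorem subst_var (A : Ty) : A.subst var = A := by
  induction A with
  | var i => rfl
  | arrow A B ihA ihB => simp only [subst, ihA, ihB]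
  | all A ih => simp only [subst, up_var, ih]

theorem ren_subst (A : Ty) (σ : ℕ → Ty) (ξ : ℕ → ℕ) : (A.ren ξ).subst σ = A.subst (σ ∘ ξ) := by
  induction A generalizing σ ξ with
  | var i => rfl
  | arrow A B ihA ihB => simp only [ren, subst, ihA, ihB]
  | all A ih => simp only [ren, subst, ih, up_comp_upr]

theorem subst_ren (A : Ty) (σ : ℕ → Ty) (ξ : ℕ → ℕ) :
    (A.subst σ).ren ξ = A.subst fun i => (σ i).ren ξ := by
  induction A generalizing σ ξ with
  | var i => rfl
  | arrow A B ihA ihB => simp only [ren, subst, ihA, ihB]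
  | all A ih =>
    have hup : (fun i => (up σ i).ren (upr ξ)) = up fun i => (σ i).ren ξ := by
      funext i
      cases i with
      | zero => rfl
      | succ i => exact lift_ren_upr (σ i) ξ
    simp only [ren, subst, ih, hup]

theorem lift_subst_one (A B : Ty) : A.lift.subst (one B) = A :=
  (ren_subst A _ _).trans (subst_var A)

theorem inst_ren (A B : Ty) (ξ : ℕ → ℕ) :
    (A.inst B).ren ξ = (A.ren (upr ξ)).inst (B.ren ξ) := by
  simp only [inst, subst_ren, ren_subst]
  congr 1
  funext i
  cases i <;> rfl

theorem ren_upr_succ_inst_var_zero (A : Ty) : (A.ren (upr Nat.succ)).inst (.var 0) = A := by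
  have hone : one (.var 0) ∘ upr Nat.succ = var := by
    funext i; cases i <;> rfl
  rw [inst, ren_subst, hone, subst_var]

end Ty

namespace Tm

theorem tren_id (t : Tm) : t.tren id = t := by
  induction t with
  | var i => rfl
  | lam A t ih => simp only [tren, ih, Ty.ren_id]
  | app t u iht ihu => simp only [tren, iht, ihu]
  | tlam t ih => simp only [tren, upr_id, ih]
  | tapp t B ih => simp only [tren, ih, Ty.ren_id]

theorem ren_id (t : Tm) : t.ren id = t := by
  induction t with
  | var i => rfl
  | lam A t ih => simp only [ren, upr_id, ih]
  | app t u iht ihu => simp only [ren, iht, ihu]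
  | tlam t ih => simp only [ren, ih]
  | tapp t B ih => simp only [ren, ih]

theorem ren_ren (t : Tm) (ξ ζ : ℕ → ℕ) : (t.ren ζ).ren ξ = t.ren (ξ ∘ ζ) := by
  induction t generalizing ξ ζ with
  | var i => rfl
  | lam A t ih => simp only [ren, ih, upr_comp_upr]
  | app t u iht ihu => simp only [ren, iht, ihu]
  | tlam t ih => simp only [ren, ih]
  | tapp t B ih => simp only [ren, ih]

theorem up_comp_upr (τ : ℕ → Tm) (ξ : ℕ → ℕ) : up τ ∘ upr ξ = up (τ ∘ ξ) := by
  funext i; cases i <;> rfl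

theorem up_var_comp (ξ : ℕ → ℕ) : up (var ∘ ξ) = var ∘ upr ξ := by
  funext i; cases i <;> rfl

theorem ren_subst (t : Tm) (τ : ℕ → Tm) (ξ : ℕ → ℕ) :
    (t.ren ξ).subst τ = t.subst (τ ∘ ξ) := by
  induction t generalizing τ ξ with
  | var i => rfl
  | lam A t ih => simp only [ren, subst, ih, up_comp_upr]
  | app t u iht ihu => simp only [ren, subst, iht, ihu]
  | tlam t ih => simp only [ren, subst, ih]; rfl
  | tapp t B ih => simp only [ren, subst, ih]

theorem subst_var_comp (t : Tm) (ξ : ℕ → ℕ) : t.subst (var ∘ ξ) = t.ren ξ := by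
  induction t generalizing ξ with
  | var i => rfl
  | lam A t ih => simp only [ren, subst, up_var_comp, ih]
  | app t u iht ihu => simp only [ren, subst, iht, ihu]
  | tlam t ih => exact congrArg tlam (ih ξ)
  | tapp t B ih => simp only [ren, subst, ih]

theorem ren_upr_add_inst_var (t : Tm) (m : ℕ) :
    (t.ren (upr (· + (m + 1)))).inst (.var m) = t.ren (· + m) := by
  have hone : one (.var m) ∘ upr (· + (m + 1)) = var ∘ (· + m) := by
    funext i
    cases i with
    | zero => simp only [Function.comp_apply, upr, one, Nat.zero_add]
    | succ i => exact congrArg var (by dsimp only; omega)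
  rw [inst, ren_subst, hone, subst_var_comp]

end Tm

theorem weaken_zero (m : ℕ) (t : Tm) : weaken 0 m t = t.ren (· + m) :=
  congrArg (Tm.ren (· + m)) t.tren_id

theorem weakenBody_zero (m : ℕ) (v : Tm) : weakenBody 0 m v = v.ren (upr (· + m)) :=
  congrArg (Tm.ren (upr (· + m))) v.tren_id

/-! ### Lists of arguments -/

theorem arrows_cons (A : Ty) (As : List Ty) (B : Ty) :
    arrows (A :: As) B = .arrow A (arrows As B) := rfl

theorem apps_cons (t u : Tm) (us : List Tm) : apps t (u :: us) = apps (.app t u) us := rfl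

/-- `λx₁ … xₙ. t`, for variables `xᵢ` of the types in a list. -/
def lams (As : List Ty) (t : Tm) : Tm := As.foldr Tm.lam t

theorem arrows_ren (As : List Ty) (B : Ty) (ξ : ℕ → ℕ) :
    (arrows As B).ren ξ = arrows (As.map (Ty.ren ξ)) (B.ren ξ) := by
  induction As with
  | nil => rfl
  | cons A As ih => simp only [arrows_cons, List.map_cons, Ty.ren, ih]

theorem arrows_subst (As : List Ty) (B : Ty) (σ : ℕ → Ty) :
    (arrows As B).subst σ = arrows (As.map (Ty.subst σ)) (B.subst σ) := by
  induction As with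
  | nil => rfl
  | cons A As ih => simp only [arrows_cons, List.map_cons, Ty.subst, ih]

theorem apps_ren (t : Tm) (us : List Tm) (ξ : ℕ → ℕ) :
    (apps t us).ren ξ = apps (t.ren ξ) (us.map (Tm.ren ξ)) := by
  induction us generalizing t with
  | nil => rfl
  | cons u us ih => simp only [apps_cons, List.map_cons, ih, Tm.ren]

theorem apps_tren (t : Tm) (us : List Tm) (ξ : ℕ → ℕ) :
    (apps t us).tren ξ = apps (t.tren ξ) (us.map (Tm.tren ξ)) := by
  induction us generalizing t with
  | nil => rfl
  | cons u us ih => simp only [apps_cons, List.map_cons, ih, Tm.tren]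

theorem map_lift_map_subst_one (As : List Ty) (B : Ty) :
    (As.map Ty.lift).map (Ty.subst (Ty.one B)) = As := by
  simp [Function.comp_def, Ty.lift_subst_one]

theorem arrows_map_lift_inst (As : List Ty) (B : Ty) :
    (arrows (As.map Ty.lift) (.var 0)).inst B = arrows As B := by
  rw [Ty.inst, arrows_subst, map_lift_map_subst_one]; rfl

theorem polynomial_inst (K : List (List Ty)) (B : Ty) :
    (polynomial K).inst B = arrows (K.map (arrows · B)) B := by
  rw [polynomial, Ty.inst, arrows_subst, List.map_map]
  exact congrArg (arrows · B) (List.map_congr_left fun As _ => arrows_map_lift_inst As B)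

theorem polynomial_ren (K : List (List Ty)) (ξ : ℕ → ℕ) :
    (polynomial K).ren (upr ξ) = polynomial (K.map (List.map (Ty.ren ξ))) := by
  simp [polynomial, arrows_ren, Function.comp_def, Ty.lift_ren_upr, Ty.ren, upr]

theorem tmVars_succ (m : ℕ) : tmVars (m + 1) = .var m :: tmVars m := by
  simp [tmVars, List.range_succ]

theorem length_tmVars (m : ℕ) : (tmVars m).length = m := by simp [tmVars]

theorem reverse_cons_append {α : Type*} (a : α) (l m : List α) :
    (a :: l).reverse ++ m = l.reverse ++ a :: m := by simp

theorem getElem?_reverse_append_add_length {α : Type*} (l m : List α) (i : ℕ) :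
    (l.reverse ++ m)[i + l.length]? = m[i]? := by
  rw [List.getElem?_append_right (by simp)]
  simp

/-! ### Fragments -/

/-- Closure of a class of types under renaming of type variables: what the metatheory of typing
requires of the classes of admitted types and of admitted instances. -/
def RenStable (P : Ty → Prop) : Prop := ∀ (ξ : ℕ → ℕ) (A : Ty), P A → P (A.ren ξ)

/-- The fragments of System F over which the `ε`-theory is studied: classes of types that contain
the type variables and are closed under renaming, `⇒` and subtypes, but not necessarily under
quantification. -/
structure IsFragment (S : Ty → Prop) : Prop where
  ren : RenStable S
  var (i : ℕ) : S (.var i)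
  arrow {A B : Ty} : S A → S B → S (.arrow A B)
  dom {A B : Ty} : S (.arrow A B) → S A
  cod {A B : Ty} : S (.arrow A B) → S B
  body {A : Ty} : S (.all A) → S A

namespace RenStable

variable {S : Ty → Prop}

theorem of_lift (hS : RenStable S) {A : Ty} (hA : S A.lift) : S A := by
  have h : A.lift.ren Nat.pred = A := (A.ren_ren _ _).trans A.ren_id
  exact h ▸ hS Nat.pred _ hA

theorem map_ren (hS : RenStable S) (ξ : ℕ → ℕ) {Γ : List Ty} (hΓ : ∀ B ∈ Γ, S B) :
    ∀ B ∈ Γ.map (Ty.ren ξ), S B :=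
  List.forall_mem_map.2 fun B hB => hS ξ B (hΓ B hB)

end RenStable

theorem arrows_mem {S : Ty → Prop} {As : List Ty} {B : Ty}
    (hS : ∀ {A B : Ty}, S A → S B → S (.arrow A B)) (hAs : ∀ A ∈ As, S A) (hB : S B) :
    S (arrows As B) := by
  induction As with
  | nil => exact hB
  | cons A As ih =>
    rw [List.forall_mem_cons] at hAs
    exact hS hAs.1 (ih hAs.2)

theorem IsFragment.of_arrows {S : Ty → Prop} {As : List Ty} {B : Ty} (hS : IsFragment S)
    (h : S (arrows As B)) : ∀ A ∈ As, S A := by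
  induction As with
  | nil => exact List.forall_mem_nil _
  | cons A As ih => exact List.forall_mem_cons.2 ⟨hS.dom h, ih (hS.cod h)⟩

/-! ### Typing -/

/-- Typing in the fragment of System F with types in `S`. -/
abbrev Typed (S : Ty → Prop) : List Ty → Tm → Ty → Prop := HasType S fun _ => True

/-- Typing in the fragment of System F with types in `S` and instantiation at type variables
only. -/
abbrev AtomTyped (S : Ty → Prop) : List Ty → Tm → Ty → Prop := HasType S fun B => ∃ i, B = .var i

theorem renStable_true : RenStable fun _ => True := fun _ _ _ => trivial

theorem renStable_isVar : RenStable fun B => ∃ i, B = .var i := by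
  rintro ξ _ ⟨i, rfl⟩
  exact ⟨ξ i, rfl⟩

/-- `ξ` maps the term variables of the context `Γ` to variables of the same type in `Δ`. -/
def RenTyped (ξ : ℕ → ℕ) (Γ Δ : List Ty) : Prop :=
  ∀ i B, Γ[i]? = some B → Δ[ξ i]? = some B

/-- `τ` maps the term variables of the context `Γ` to terms of the same type in `Δ`. -/
def SubstTyped (S I : Ty → Prop) (τ : ℕ → Tm) (Γ Δ : List Ty) : Prop :=
  ∀ i B, Γ[i]? = some B → HasType S I Δ (τ i) B

namespace RenTyped

variable {ξ : ℕ → ℕ} {Γ Δ : List Ty}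

theorem upr (h : RenTyped ξ Γ Δ) (A : Ty) : RenTyped (upr ξ) (A :: Γ) (A :: Δ) := by
  intro i B hi
  cases i with
  | zero => exact hi
  | succ i => exact h i B hi

theorem map_lift (h : RenTyped ξ Γ Δ) : RenTyped ξ (Γ.map Ty.lift) (Δ.map Ty.lift) := by
  intro i B hi
  rw [List.getElem?_map, Option.map_eq_some_iff] at hi ⊢
  obtain ⟨C, hC, rfl⟩ := hi
  exact ⟨C, h i C hC, rfl⟩

theorem succ (Γ : List Ty) (A : Ty) : RenTyped Nat.succ Γ (A :: Γ) := fun _ _ => id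

theorem add_length (Γ As : List Ty) : RenTyped (· + As.length) Γ (As.reverse ++ Γ) :=
  fun i _ hi => (getElem?_reverse_append_add_length As Γ i).trans hi

end RenTyped

namespace HasType

variable {S I : Ty → Prop} {Γ Δ : List Ty} {t : Tm} {A B : Ty}

theorem mono {S' I' : Ty → Prop} (hS : ∀ A, S A → S' A) (hI : ∀ A, I A → I' A)
    (h : HasType S I Γ t A) : HasType S' I' Γ t A := by
  induction h with
  | var hΓ hi => exact .var (fun B hB => hS B (hΓ B hB)) hi
  | lam hAB _ ih => exact .lam (hS _ hAB) ih
  | app hB _ _ iht ihu => exact .app (hS _ hB) iht ihu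
  | tlam hA _ ih => exact .tlam (hS _ hA) ih
  | tapp hB hIB hAB _ ih => exact .tapp (hS _ hB) (hI _ hIB) (hS _ hAB) ih

theorem typed (h : HasType S I Γ t A) : Typed S Γ t A :=
  h.mono (fun _ => id) fun _ _ => trivial

theorem type_mem (h : HasType S I Γ t A) : S A := by
  cases h with
  | var hΓ hi => exact hΓ _ (List.mem_of_getElem? hi)
  | lam hAB _ => exact hAB
  | app hB _ _ => exact hB
  | tlam hA _ => exact hA
  | tapp _ _ hAB _ => exact hAB

theorem ctx_mem (hS : RenStable S) (h : HasType S I Γ t A) : ∀ B ∈ Γ, S B := by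
  induction h with
  | var hΓ _ => exact hΓ
  | lam _ _ ih => exact (List.forall_mem_cons.1 ih).2
  | app _ _ _ ih _ => exact ih
  | tlam _ _ ih => exact fun B hB => hS.of_lift (ih _ (List.mem_map_of_mem hB))
  | tapp _ _ _ _ ih => exact ih

theorem var_zero (hA : S A) (hΓ : ∀ B ∈ Γ, S B) : HasType S I (A :: Γ) (.var 0) A :=
  .var (List.forall_mem_cons.2 ⟨hA, hΓ⟩) rfl

theorem tren (hS : RenStable S) (hI : RenStable I) (h : HasType S I Γ t A) (ξ : ℕ → ℕ) :
    HasType S I (Γ.map (Ty.ren ξ)) (t.tren ξ) (A.ren ξ) := by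
  induction h generalizing ξ with
  | var hΓ hi => exact .var (hS.map_ren ξ hΓ) (by rw [List.getElem?_map, hi, Option.map_some])
  | lam hAB _ ih => exact .lam (hS ξ _ hAB) (ih ξ)
  | app hB _ _ iht ihu => exact .app (hS ξ _ hB) (iht ξ) (ihu ξ)
  | tlam hA _ ih =>
    refine .tlam (hS ξ _ hA) ?_
    convert ih (upr ξ) using 1
    simp only [List.map_map, Function.comp_def, Ty.lift_ren_upr]
  | tapp hB hIB hAB _ ih =>
    have hABξ := hS ξ _ hAB
    rw [Ty.inst_ren] at hABξ ⊢
    exact .tapp (hS ξ _ hB) (hI ξ _ hIB) hABξ (ih ξ)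

theorem ren (hS : RenStable S) (h : HasType S I Γ t A) {ξ : ℕ → ℕ} (hΔ : ∀ B ∈ Δ, S B)
    (hξ : RenTyped ξ Γ Δ) : HasType S I Δ (t.ren ξ) A := by
  induction h generalizing Δ ξ with
  | var _ hi => exact .var hΔ (hξ _ _ hi)
  | @lam Γ A B t hAB ht ih =>
    have hA := (List.forall_mem_cons.1 (ht.ctx_mem hS)).1
    exact .lam hAB (ih (List.forall_mem_cons.2 ⟨hA, hΔ⟩) (hξ.upr A))
  | app hB _ _ iht ihu => exact .app hB (iht hΔ hξ) (ihu hΔ hξ)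
  | tlam hA _ ih => exact .tlam hA (ih (hS.map_ren _ hΔ) hξ.map_lift)
  | tapp hB hIB hAB _ ih => exact .tapp hB hIB hAB (ih hΔ hξ)

theorem ren_succ (hS : RenStable S) (h : HasType S I Γ t A) (hB : S B) :
    HasType S I (B :: Γ) (t.ren Nat.succ) A :=
  h.ren hS (List.forall_mem_cons.2 ⟨hB, h.ctx_mem hS⟩) (.succ Γ B)

theorem ren_add_length (hS : RenStable S) (h : HasType S I Γ t A) {Bs : List Ty}
    (hBs : ∀ B ∈ Bs, S B) : HasType S I (Bs.reverse ++ Γ) (t.ren (· + Bs.length)) A := by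
  refine h.ren hS (List.forall_mem_append.2 ⟨?_, h.ctx_mem hS⟩) (.add_length Γ Bs)
  exact fun B hB => hBs B (List.mem_reverse.1 hB)

end HasType

namespace SubstTyped

variable {S I : Ty → Prop} {τ : ℕ → Tm} {Γ Δ : List Ty} {u : Tm} {A : Ty}

theorem up (hS : RenStable S) (h : SubstTyped S I τ Γ Δ) (hA : S A) (hΔ : ∀ B ∈ Δ, S B) :
    SubstTyped S I (Tm.up τ) (A :: Γ) (A :: Δ) := by
  intro i B hi
  cases i with
  | zero => exact .var (List.forall_mem_cons.2 ⟨hA, hΔ⟩) hi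
  | succ i => exact (h i B hi).ren_succ hS hA

theorem map_lift (hS : RenStable S) (hI : RenStable I) (h : SubstTyped S I τ Γ Δ) :
    SubstTyped S I (fun i => (τ i).tren Nat.succ) (Γ.map Ty.lift) (Δ.map Ty.lift) := by
  intro i B hi
  rw [List.getElem?_map, Option.map_eq_some_iff] at hi
  obtain ⟨C, hC, rfl⟩ := hi
  exact (h i C hC).tren hS hI Nat.succ

theorem one (hS : RenStable S) (hu : HasType S I Γ u A) :
    SubstTyped S I (Tm.one u) (A :: Γ) Γ := by
  intro i B hi
  cases i with
  | zero => exact Option.some.inj hi ▸ hu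
  | succ i => exact .var (hu.ctx_mem hS) hi

end SubstTyped

namespace HasType

variable {S I : Ty → Prop} {Γ Δ As : List Ty} {t u : Tm} {us : List Tm} {A B : Ty}

theorem subst (hS : RenStable S) (hI : RenStable I) (h : HasType S I Γ t A) {τ : ℕ → Tm}
    (hΔ : ∀ B ∈ Δ, S B) (hτ : SubstTyped S I τ Γ Δ) : HasType S I Δ (t.subst τ) A := by
  induction h generalizing Δ τ with
  | var _ hi => exact hτ _ _ hi
  | lam hAB ht ih =>
    have hA := (List.forall_mem_cons.1 (ht.ctx_mem hS)).1
    exact .lam hAB (ih (List.forall_mem_cons.2 ⟨hA, hΔ⟩) (hτ.up hS hA hΔ))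
  | app hB _ _ iht ihu => exact .app hB (iht hΔ hτ) (ihu hΔ hτ)
  | tlam hA _ ih => exact .tlam hA (ih (hS.map_ren _ hΔ) (hτ.map_lift hS hI))
  | tapp hB hIB hAB _ ih => exact .tapp hB hIB hAB (ih hΔ hτ)

theorem inst (hS : RenStable S) (hI : RenStable I) (ht : HasType S I (A :: Γ) t B)
    (hu : HasType S I Γ u A) : HasType S I Γ (t.inst u) B :=
  ht.subst hS hI (hu.ctx_mem hS) (.one hS hu)

theorem app_ren_succ (hS : IsFragment S) (h : HasType S I Γ t (.arrow A B)) :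
    HasType S I (A :: Γ) (.app (t.ren Nat.succ) (.var 0)) B :=
  have hA := hS.dom h.type_mem
  .app (hS.cod h.type_mem) (h.ren_succ hS.ren hA) (var_zero hA (h.ctx_mem hS.ren))

theorem tapp_tren_succ (hS : IsFragment S) (hI : RenStable I) (hI₀ : I (.var 0))
    (h : HasType S I Γ t (.all A)) :
    HasType S I (Γ.map Ty.lift) (.tapp (t.tren Nat.succ) (.var 0)) A := by
  have hA := A.ren_upr_succ_inst_var_zero
  have htapp := HasType.tapp (A := A.ren (upr Nat.succ)) (hS.var 0) hI₀
    (hA.symm ▸ hS.body h.type_mem) (h.tren hS.ren hI Nat.succ)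
  rwa [hA] at htapp

theorem lams (hS : IsFragment S) (h : HasType S I (As.reverse ++ Γ) t B) :
    HasType S I Γ (lams As t) (arrows As B) := by
  induction As generalizing Γ with
  | nil => exact h
  | cons A As ih =>
    rw [reverse_cons_append] at h
    have hA := h.ctx_mem hS.ren A (by simp)
    exact .lam (hS.arrow hA (ih h).type_mem) (ih h)

theorem apps (hS : IsFragment S) (ht : HasType S I Γ t (arrows As B))
    (hus : List.Forall₂ (fun A u => HasType S I Γ u A) As us) :
    HasType S I Γ (apps t us) B := by
  induction hus generalizing t with
  | nil => exact ht
  | cons hu _ ih => exact ih (.app (hS.cod ht.type_mem) ht hu)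

theorem tmVars (hΓ : ∀ B ∈ As.reverse ++ Γ, S B) :
    List.Forall₂ (fun A u => HasType S I (As.reverse ++ Γ) u A) As (tmVars As.length) := by
  induction As generalizing Γ with
  | nil => exact .nil
  | cons A As ih =>
    rw [List.length_cons, tmVars_succ]
    refine .cons (.var hΓ (by simp)) ?_
    rw [reverse_cons_append] at hΓ ⊢
    exact ih hΓ

theorem apps_tmVars (hS : IsFragment S) (h : HasType S I Γ t (SystemF.arrows As B)) :
    HasType S I (As.reverse ++ Γ)
      (SystemF.apps (t.ren (· + As.length)) (SystemF.tmVars As.length)) B :=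
  have ht := h.ren_add_length hS.ren (hS.of_arrows h.type_mem)
  ht.apps hS (tmVars (ht.ctx_mem hS.ren))

end HasType

/-! ### Iterated congruence, `β` and `η` -/

namespace EpsEq

variable {S : Ty → Prop} {Γ As : List Ty} {t t' u : Tm} {us : List Tm} {B : Ty}

theorem apps_left (hS : IsFragment S) (h : EpsEq S Γ t t' (arrows As B)) (hAs : S (arrows As B))
    (hus : List.Forall₂ (fun A u => Typed S Γ u A) As us) :
    EpsEq S Γ (apps t us) (apps t' us) B := by
  induction hus generalizing t t' with
  | nil => exact h
  | cons hu _ ih => exact ih (.app (hS.cod hAs) h (.refl hu)) (hS.cod hAs)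

theorem apps_lams (hS : IsFragment S) (hu : Typed S (As.reverse ++ Γ) u B) :
    EpsEq S (As.reverse ++ Γ) (apps ((lams As u).ren (· + As.length)) (tmVars As.length)) u B := by
  induction As generalizing Γ with
  | nil =>
    have hren : apps ((lams [] u).ren (· + 0)) (tmVars 0) = u := u.ren_id
    exact hren.symm ▸ .refl hu
  | cons A As ih =>
    have hvars := HasType.tmVars (I := fun _ => True) (hu.ctx_mem hS.ren)
    have hlam : Typed S _ ((lams (A :: As) u).ren (· + (As.length + 1))) (arrows (A :: As) B) :=
      (HasType.lams hS hu).ren_add_length hS.ren (hS.of_arrows (HasType.lams hS hu).type_mem)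
    rw [List.length_cons, tmVars_succ] at hvars ⊢
    rw [reverse_cons_append] at hu hlam hvars ⊢
    have hAAs := hlam.type_mem
    cases hlam with
    | lam _ hbody =>
      cases hvars with
      | cons hvar hvars =>
        have hbeta := EpsEq.beta hAAs hbody hvar
        rw [Tm.ren_upr_add_inst_var] at hbeta
        exact (hbeta.apps_left hS (hS.cod hAAs) hvars).trans (ih hu)

theorem lams_of_apps_tmVars (hS : IsFragment S) (ht : Typed S Γ t (arrows As B))
    (h : EpsEq S (As.reverse ++ Γ) (apps (t.ren (· + As.length)) (tmVars As.length)) u B) :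
    EpsEq S Γ t (lams As u) (arrows As B) := by
  induction As generalizing Γ t with
  | nil => exact (show apps (t.ren (· + 0)) (tmVars 0) = t from t.ren_id) ▸ h
  | cons A As ih =>
    rw [reverse_cons_append, List.length_cons, tmVars_succ, apps_cons] at h
    have hshift : (Tm.app (t.ren Nat.succ) (.var 0)).ren (· + As.length) =
        .app (t.ren (· + (As.length + 1))) (.var As.length) := by
      have hadd : (· + As.length) ∘ Nat.succ = (· + (As.length + 1)) := by
        funext i; simp only [Function.comp_apply]; omega
      simp only [Tm.ren, Tm.ren_ren, hadd, Nat.zero_add]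
    exact (EpsEq.eta ht).trans (.lam ht.type_mem (ih (ht.app_ren_succ hS) (hshift ▸ h)))

end EpsEq

/-! ### The functorial action on a type without the distinguished variable -/

/-- The type variable `i` does not occur in `A`: its occurrences are both all positive and all
negative. -/
def Ty.NotOcc (A : Ty) (i : ℕ) : Prop := ∀ pos, A.Occ pos i

theorem Ty.notOcc_ren {A : Ty} {i : ℕ} {ξ : ℕ → ℕ} (hξ : ∀ j, ξ j ≠ i) : (A.ren ξ).NotOcc i := by
  intro pos
  induction A generalizing i ξ pos with
  | var j => exact fun h => absurd h (hξ j)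
  | arrow A B ihA ihB => exact ⟨ihA hξ _, ihB hξ _⟩
  | all _ ih =>
    refine ih (fun j => ?_) pos
    cases j with
    | zero => exact (Nat.succ_ne_zero i).symm
    | succ j => exact fun h => hξ j (Nat.succ_injective h)

theorem Ty.notOcc_lift (A : Ty) : A.lift.NotOcc 0 := notOcc_ren (A := A) Nat.succ_ne_zero

theorem Ty.NotOcc.dom {A B : Ty} {i : ℕ} (h : (Ty.arrow A B).NotOcc i) : A.NotOcc i :=
  fun pos => Bool.not_not pos ▸ (h (!pos)).1

theorem Ty.NotOcc.cod {A B : Ty} {i : ℕ} (h : (Ty.arrow A B).NotOcc i) : B.NotOcc i :=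
  fun pos => (h pos).2

theorem act_var_of_notOcc {i j : ℕ} (h : (Ty.var j).NotOcc i) (P Q : ℕ → Ty) (v s : Tm) :
    act (.var j) i P Q v s = s :=
  if_neg fun hji => Bool.false_ne_true (h false hji)

section Action

variable {S : Ty → Prop} {Γ : List Ty} {A E F : Ty} {i : ℕ} {P Q : ℕ → Ty} {v s : Tm}

theorem HasType.act_of_notOcc (hS : IsFragment S) (hi : A.NotOcc i)
    (hPQ : A.subst P = A.subst Q) (hs : Typed S Γ s (A.subst P)) :
    Typed S Γ (act A i P Q v s) (A.subst Q) := by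
  induction A generalizing Γ i P Q v s with
  | var j =>
    rw [act_var_of_notOcc hi]
    exact hPQ ▸ hs
  | arrow C D ihC ihD =>
    obtain ⟨hC, hD⟩ := Ty.arrow.inj hPQ
    have hCD : S (.arrow (C.subst P) (D.subst P)) := hs.type_mem
    have hx : Typed S (C.subst Q :: Γ) (.var 0) (C.subst Q) :=
      .var_zero (hC ▸ hS.dom hCD) (hs.ctx_mem hS.ren)
    have hsx := HasType.app (hS.cod hCD) (hs.ren_succ hS.ren (hC ▸ hS.dom hCD))
      (ihC (v := v.ren (upr Nat.succ)) hi.dom hC.symm hx)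
    exact .lam (hC ▸ hD ▸ hCD) (ihD hi.cod hD hsx)
  | all C ih =>
    have hsY := hs.tapp_tren_succ hS renStable_true trivial
    have hsQ : Typed S Γ s ((Ty.all C).subst Q) := hPQ ▸ hs
    exact .tlam hsQ.type_mem (ih hi (Ty.all.inj hPQ) hsY)

theorem EpsEq.act_of_notOcc (hS : IsFragment S) (hi : A.NotOcc i)
    (hPQ : A.subst P = A.subst Q) (hs : Typed S Γ s (A.subst P)) :
    EpsEq S Γ s (act A i P Q v s) (A.subst Q) := by
  induction A generalizing Γ i P Q v s with
  | var j =>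
    rw [act_var_of_notOcc hi]
    exact .refl (hPQ ▸ hs)
  | arrow C D ihC ihD =>
    obtain ⟨hC, hD⟩ := Ty.arrow.inj hPQ
    have hsQ : Typed S Γ s ((Ty.arrow C D).subst Q) := hPQ ▸ hs
    have hCD : S (.arrow (C.subst Q) (D.subst Q)) := hsQ.type_mem
    have hx : Typed S (C.subst Q :: Γ) (.var 0) (C.subst Q) :=
      .var_zero (hS.dom hCD) (hs.ctx_mem hS.ren)
    have hs' : Typed S (C.subst Q :: Γ) (s.ren Nat.succ) (.arrow (C.subst P) (D.subst P)) :=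
      hs.ren_succ hS.ren (hS.dom hCD)
    have hsx : Typed S (C.subst Q :: Γ)
        (.app (s.ren Nat.succ) (act C i Q P (v.ren (upr Nat.succ)) (.var 0))) (D.subst P) :=
      .app (hS.cod hs'.type_mem) hs' (HasType.act_of_notOcc hS hi.dom hC.symm hx)
    have happ := EpsEq.app (hS.cod hs'.type_mem) (.refl hs')
      (ihC (v := v.ren (upr Nat.succ)) hi.dom hC.symm hx)
    exact (EpsEq.eta hsQ).trans (.lam hCD ((hD ▸ happ).trans (ihD hi.cod hD hsx)))
  | all C ih =>
    have hsY := hs.tapp_tren_succ hS renStable_true trivial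
    have hsQ : Typed S Γ s ((Ty.all C).subst Q) := hPQ ▸ hs
    exact (EpsEq.teta hsQ).trans (.tlam hsQ.type_mem (ih hi (Ty.all.inj hPQ) hsY))

theorem EpsEq.act_lift (hS : IsFragment S) (hs : Typed S Γ s A) :
    EpsEq S Γ s (act A.lift 0 (Ty.one E) (Ty.one F) v s) A := by
  have h := EpsEq.act_of_notOcc (P := Ty.one E) (Q := Ty.one F) (v := v) hS A.notOcc_lift
    (by simp only [Ty.lift_subst_one]) ((A.lift_subst_one E).symm ▸ hs)
  rwa [Ty.lift_subst_one] at h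

theorem EpsEq.apps_act_lift (hS : IsFragment S) {As : List Ty} {us : List Tm} {B : Ty} {t t' : Tm}
    (h : EpsEq S Γ t t' (arrows As B)) (hAs : S (arrows As B))
    (hus : List.Forall₂ (fun A u => Typed S Γ u A) As us) :
    EpsEq S Γ (apps t us)
      (apps t' (List.zipWith (fun A z => act A 0 (Ty.one E) (Ty.one F) v z) (As.map Ty.lift) us))
      B := by
  induction hus generalizing t t' with
  | nil => exact h
  | cons hu _ ih => exact ih (.app (hS.cod hAs) h (.act_lift hS hu)) (hS.cod hAs)

end Action

/-! ### The `ε`-rule for polynomial types -/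

/-- An argument type `⟨A₁, …, Aₘ⟩ ⇒ X` of a polynomial type, with a term of this type for some
instance of `X`. The types `Aⱼ` live outside the binder of `X`, unlike those of `AlgArg`. -/
structure PolyArg where
  dom : List Ty
  tm : Tm

namespace PolyArg

/-- Renaming of term variables in an argument. -/
def ren (ξ : ℕ → ℕ) (p : PolyArg) : PolyArg := ⟨p.dom, p.tm.ren ξ⟩

/-- Renaming of type variables in an argument. -/
def tren (ξ : ℕ → ℕ) (p : PolyArg) : PolyArg := ⟨p.dom.map (Ty.ren ξ), p.tm.tren ξ⟩

/-- For `x : E ⊢ v : F`, the argument `λz⃗. v[e z⃗]` with instance `F` obtained from an argument `e`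
with instance `E`. It is the choice of `fₖ` for which the premises of the `ε`-rule hold. -/
def post (v : Tm) (p : PolyArg) : PolyArg :=
  ⟨p.dom, lams p.dom ((v.ren (upr (· + p.dom.length))).inst
    (apps (p.tm.ren (· + p.dom.length)) (tmVars p.dom.length)))⟩

/-- The argument `p` with its image under `v`, in the format of the `ε`-rule. -/
def toAlgArg (v : Tm) (p : PolyArg) : AlgArg := ⟨0, p.dom.map Ty.lift, p.tm, (p.post v).tm⟩

variable {S I : Ty → Prop} {Γ : List Ty} {E F : Ty} {v : Tm} {p : PolyArg}

theorem toAlgArg_ty_inst (v : Tm) (p : PolyArg) (E : Ty) :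
    (p.toAlgArg v).ty.inst E = arrows p.dom E := arrows_map_lift_inst p.dom E

theorem all_arrows_toAlgArg_ty (v : Tm) (L : List PolyArg) :
    .all (arrows ((L.map (toAlgArg v)).map AlgArg.ty) (.var 0)) =
      Ty.all (polynomial (L.map PolyArg.dom)) := by
  simp only [polynomial, List.map_map]
  rfl

theorem hasType_post_body (hS : IsFragment S) (hI : RenStable I) (hv : HasType S I (E :: Γ) v F)
    (hp : HasType S I Γ p.tm (arrows p.dom E)) :
    HasType S I (p.dom.reverse ++ Γ) ((v.ren (upr (· + p.dom.length))).inst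
      (apps (p.tm.ren (· + p.dom.length)) (tmVars p.dom.length))) F := by
  have hpz := hp.apps_tmVars hS
  refine .inst hS.ren hI (hv.ren hS.ren ?_ ((RenTyped.add_length Γ p.dom).upr E)) hpz
  exact List.forall_mem_cons.2 ⟨hpz.type_mem, hpz.ctx_mem hS.ren⟩

theorem hasType_post (hS : IsFragment S) (hI : RenStable I) (hv : HasType S I (E :: Γ) v F)
    (hp : HasType S I Γ p.tm (arrows p.dom E)) :
    HasType S I Γ (p.post v).tm (arrows p.dom F) :=
  .lams hS (hasType_post_body hS hI hv hp)

theorem epsEq_post (hS : IsFragment S) (hv : Typed S (E :: Γ) v F)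
    (hp : Typed S Γ p.tm (arrows p.dom E)) :
    EpsEq S (p.dom.reverse ++ Γ)
      ((v.ren (upr (· + p.dom.length))).inst
        (apps (p.tm.ren (· + p.dom.length)) (tmVars p.dom.length)))
      (apps ((p.post v).tm.ren (· + p.dom.length))
        (List.zipWith
          (fun A z => act A 0 (Ty.one E) (Ty.one F) (v.ren (upr (· + p.dom.length))) z)
          (p.dom.map Ty.lift) (tmVars p.dom.length)))
      F := by
  have hbeta := EpsEq.apps_lams hS (hasType_post_body hS renStable_true hv hp)
  have hf := (hasType_post hS renStable_true hv hp).ren_add_length hS.ren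
    (hS.of_arrows hp.type_mem)
  have hvars := HasType.tmVars (I := fun _ => True) (hf.ctx_mem hS.ren)
  exact hbeta.symm.trans (.apps_act_lift hS (.refl hf) hf.type_mem hvars)

theorem map_dom_ren (L : List PolyArg) (ξ : ℕ → ℕ) :
    (L.map (PolyArg.ren ξ)).map PolyArg.dom = L.map PolyArg.dom := List.map_map

theorem map_dom_tren (L : List PolyArg) (ξ : ℕ → ℕ) :
    (L.map (PolyArg.tren ξ)).map PolyArg.dom = (L.map PolyArg.dom).map (List.map (Ty.ren ξ)) := by
  rw [List.map_map, List.map_map]; rfl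

theorem map_dom_post (L : List PolyArg) (v : Tm) :
    (L.map (PolyArg.post v)).map PolyArg.dom = L.map PolyArg.dom := List.map_map

end PolyArg

/-- The application `t E ⟨eₖ⟩ₖ` is well-typed, for a term `t` of type `∀X.P[X]` and a list `L` of as
many arguments `eₖ` as the polynomial type `P[X]` has. -/
structure SaturatedApp (S I : Ty → Prop) (Γ : List Ty) (t : Tm) (E : Ty) (L : List PolyArg) :
    Prop where
  head : HasType S I Γ t (.all (polynomial (L.map PolyArg.dom)))
  args : ∀ p ∈ L, HasType S I Γ p.tm (arrows p.dom E)

namespace SaturatedApp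

variable {S I : Ty → Prop} {Γ : List Ty} {t v : Tm} {A E F : Ty} {L : List PolyArg}

theorem ren_succ (hS : RenStable S) (h : SaturatedApp S I Γ t E L) (hA : S A) :
    SaturatedApp S I (A :: Γ) (t.ren Nat.succ) E (L.map (PolyArg.ren Nat.succ)) where
  head := PolyArg.map_dom_ren L _ ▸ h.head.ren_succ hS hA
  args := List.forall_mem_map.2 fun p hp => (h.args p hp).ren_succ hS hA

theorem tren_succ (hS : RenStable S) (hI : RenStable I) (h : SaturatedApp S I Γ t E L) :
    SaturatedApp S I (Γ.map Ty.lift) (t.tren Nat.succ) E.lift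
      (L.map (PolyArg.tren Nat.succ)) where
  head := by
    rw [PolyArg.map_dom_tren, ← polynomial_ren]
    exact h.head.tren hS hI Nat.succ
  args := List.forall_mem_map.2 fun p hp =>
    arrows_ren p.dom E Nat.succ ▸ (h.args p hp).tren hS hI Nat.succ

theorem post (hS : IsFragment S) (hI : RenStable I) (h : SaturatedApp S I Γ t E L)
    (hv : HasType S I (E :: Γ) v F) : SaturatedApp S I Γ t F (L.map (PolyArg.post v)) where
  head := PolyArg.map_dom_post L v ▸ h.head
  args := List.forall_mem_map.2 fun p hp => PolyArg.hasType_post hS hI hv (h.args p hp)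

theorem hasType (hS : IsFragment S) (hE : S E) (hIE : I E) (h : SaturatedApp S I Γ t E L) :
    HasType S I Γ (apps (.tapp t E) (L.map PolyArg.tm)) E := by
  have hinst : (polynomial (L.map PolyArg.dom)).inst E =
      arrows (L.map fun p => arrows p.dom E) E := by
    rw [polynomial_inst, List.map_map]; rfl
  have hargs := arrows_mem hS.arrow (List.forall_mem_map.2 fun p hp => (h.args p hp).type_mem) hE
  have htE := HasType.tapp hE hIE (hinst ▸ hargs) h.head
  rw [hinst] at htE
  refine htE.apps hS ?_
  rw [List.forall₂_map_left_iff, List.forall₂_map_right_iff, List.forall₂_same]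
  exact h.args

theorem epsEq_post (hS : IsFragment S) (h : SaturatedApp S (fun _ => True) Γ t E L)
    (hv : Typed S (E :: Γ) v F) :
    EpsEq S Γ (v.inst (apps (.tapp t E) (L.map PolyArg.tm)))
      (apps (.tapp t F) ((L.map (PolyArg.post v)).map PolyArg.tm)) F := by
  have hE : S E := (List.forall_mem_cons.1 (hv.ctx_mem hS.ren)).1
  have hdom : ∀ d ∈ L.map (PolyArg.toAlgArg v), ∀ A ∈ d.dom, A.Occ true d.n :=
    List.forall_mem_map.2 fun _ _ => List.forall_mem_map.2 fun A _ => A.notOcc_lift true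
  have hsrc : ∀ d ∈ L.map (PolyArg.toAlgArg v), Typed S Γ d.src (d.ty.inst E) :=
    List.forall_mem_map.2 fun p hp => p.toAlgArg_ty_inst v E ▸ h.args p hp
  have htgt : ∀ d ∈ L.map (PolyArg.toAlgArg v), Typed S Γ d.tgt (d.ty.inst F) :=
    List.forall_mem_map.2 fun p hp =>
      p.toAlgArg_ty_inst v F ▸ PolyArg.hasType_post hS renStable_true hv (h.args p hp)
  have heps := EpsEq.eps_pos (B := .var 0) hE hv.type_mem (fun _ => rfl) hdom
    (PolyArg.all_arrows_toAlgArg_ty v L ▸ h.head) hsrc htgt hv <|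
    List.forall_mem_map.2 fun p hp => by
      have hren : Ty.ren (· + 0) = id := funext Ty.ren_id
      have hone (G : Ty) : Ty.oneAt 0 G = Ty.one G := rfl
      simp only [PolyArg.toAlgArg, hone, hren, map_lift_map_subst_one, List.map_id,
        List.length_map, weaken_zero, weakenBody_zero, id]
      exact PolyArg.epsEq_post hS hv (h.args p hp)
  simp only [List.map_map] at heps ⊢
  exact heps

end SaturatedApp

/-! ### Atomization -/

theorem hasType_app_var_zero_var_one {S I : Ty → Prop} {Γ : List Ty} {C D : Ty}
    (hS : IsFragment S) (hCD : S (.arrow C D)) (hΓ : ∀ A ∈ Γ, S A) :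
    HasType S I (.arrow C D :: C :: Γ) (.app (.var 0) (.var 1)) D :=
  have hx : HasType S I (.arrow C D :: C :: Γ) (.var 0) (.arrow C D) :=
    .var_zero hCD (List.forall_mem_cons.2 ⟨hS.dom hCD, hΓ⟩)
  .app (hS.cod hCD) hx (.var (hx.ctx_mem hS.ren) rfl)

theorem hasType_tapp_var_zero_var_zero {S I : Ty → Prop} {Γ : List Ty} {D : Ty}
    (hS : IsFragment S) (hI : RenStable I) (hI₀ : I (.var 0)) (hD : S (.all D))
    (hΓ : ∀ A ∈ Γ, S A) :
    HasType S I ((Ty.all D).lift :: Γ.map Ty.lift) (.tapp (.var 0) (.var 0)) D :=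
  (HasType.var_zero hD hΓ).tapp_tren_succ hS hI hI₀

/-- The atomic form of the saturated application `t B ⟨eₖ⟩ₖ` of an instance of a polynomial type, by
recursion on `B`. -/
def atomApps : Ty → Tm → List PolyArg → Tm
  | .var i, t, L => apps (.tapp t (.var i)) (L.map PolyArg.tm)
  | .arrow C D, t, L =>
      .lam C (atomApps D (t.ren Nat.succ)
        ((L.map (PolyArg.ren Nat.succ)).map (PolyArg.post (.app (.var 0) (.var 1)))))
  | .all D, t, L =>
      .tlam (atomApps D (t.tren Nat.succ)
        ((L.map (PolyArg.tren Nat.succ)).map (PolyArg.post (.tapp (.var 0) (.var 0)))))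

/-- The variables `xₖ` of types `⟨Aⱼₖ⟩ⱼ ⇒ B` over which an instance `t B` of a polynomial type is
`η`-expanded, as arguments. -/
def varArgs (K : List (List Ty)) : List PolyArg :=
  (K.zip (tmVars K.length)).map fun q => ⟨q.1, q.2⟩

/-- The atomic form of an instance `t B` of a polynomial type. -/
def atomTapp (K : List (List Ty)) (t : Tm) (B : Ty) : Tm :=
  lams (K.map (arrows · B)) (atomApps B (t.ren (· + K.length)) (varArgs K))

theorem map_dom_varArgs (K : List (List Ty)) : (varArgs K).map PolyArg.dom = K := by
  rw [varArgs, List.map_map]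
  exact List.map_fst_zip (length_tmVars K.length).ge

theorem map_tm_varArgs (K : List (List Ty)) : (varArgs K).map PolyArg.tm = tmVars K.length := by
  rw [varArgs, List.map_map]
  exact List.map_snd_zip (length_tmVars K.length).le

namespace SaturatedApp

variable {S I : Ty → Prop} {Γ : List Ty} {t : Tm} {B C D : Ty} {L : List PolyArg}

theorem post_arrow (hS : IsFragment S) (hI : RenStable I) (hCD : S (.arrow C D))
    (h : SaturatedApp S I Γ t (.arrow C D) L) :
    SaturatedApp S I (C :: Γ) (t.ren Nat.succ) D
      ((L.map (PolyArg.ren Nat.succ)).map (PolyArg.post (.app (.var 0) (.var 1)))) :=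
  (h.ren_succ hS.ren (hS.dom hCD)).post hS hI
    (hasType_app_var_zero_var_one hS hCD (h.head.ctx_mem hS.ren))

theorem post_all (hS : IsFragment S) (hI : RenStable I) (hI₀ : I (.var 0)) (hD : S (.all D))
    (h : SaturatedApp S I Γ t (.all D) L) :
    SaturatedApp S I (Γ.map Ty.lift) (t.tren Nat.succ) D
      ((L.map (PolyArg.tren Nat.succ)).map (PolyArg.post (.tapp (.var 0) (.var 0)))) :=
  (h.tren_succ hS.ren hI).post hS hI
    (hasType_tapp_var_zero_var_zero hS hI hI₀ hD (h.head.ctx_mem hS.ren))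

theorem hasType_atomApps (hS : IsFragment S) (hI : RenStable I) (hIvar : ∀ i, I (.var i))
    (hB : S B) (h : SaturatedApp S I Γ t B L) : HasType S I Γ (atomApps B t L) B := by
  induction B generalizing Γ t L with
  | var i => exact h.hasType hS hB (hIvar i)
  | arrow C D _ ih => exact .lam hB (ih (hS.cod hB) (h.post_arrow hS hI hB))
  | all D ih => exact .tlam hB (ih (hS.body hB) (h.post_all hS hI (hIvar 0) hB))

theorem epsEq_post_arrow (hS : IsFragment S) (hCD : S (.arrow C D))
    (h : SaturatedApp S (fun _ => True) Γ t (.arrow C D) L) :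
    EpsEq S (C :: Γ) (.app ((apps (.tapp t (.arrow C D)) (L.map PolyArg.tm)).ren Nat.succ) (.var 0))
      (apps (.tapp (t.ren Nat.succ) D) (((L.map (PolyArg.ren Nat.succ)).map
        (PolyArg.post (.app (.var 0) (.var 1)))).map PolyArg.tm)) D := by
  have heps := (h.ren_succ hS.ren (hS.dom hCD)).epsEq_post hS
    (hasType_app_var_zero_var_one hS hCD (h.head.ctx_mem hS.ren))
  rw [apps_ren, List.map_map]
  rw [List.map_map] at heps
  exact heps

theorem epsEq_post_all (hS : IsFragment S) (hD : S (.all D))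
    (h : SaturatedApp S (fun _ => True) Γ t (.all D) L) :
    EpsEq S (Γ.map Ty.lift)
      (.tapp ((apps (.tapp t (.all D)) (L.map PolyArg.tm)).tren Nat.succ) (.var 0))
      (apps (.tapp (t.tren Nat.succ) D) (((L.map (PolyArg.tren Nat.succ)).map
        (PolyArg.post (.tapp (.var 0) (.var 0)))).map PolyArg.tm)) D := by
  have heps := (h.tren_succ hS.ren renStable_true).epsEq_post hS
    (hasType_tapp_var_zero_var_zero hS renStable_true trivial hD (h.head.ctx_mem hS.ren))
  rw [apps_tren, List.map_map]
  rw [List.map_map] at heps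
  exact heps

theorem epsEq_atomApps (hS : IsFragment S) (hB : S B)
    (h : SaturatedApp S (fun _ => True) Γ t B L) :
    EpsEq S Γ (apps (.tapp t B) (L.map PolyArg.tm)) (atomApps B t L) B := by
  have happ := h.hasType hS hB trivial
  induction B generalizing Γ t L with
  | var i => exact .refl happ
  | arrow C D _ ih =>
    have hpost := h.post_arrow hS renStable_true hB
    have hD := hS.cod hB
    exact (EpsEq.eta happ).trans <| .lam hB <|
      (h.epsEq_post_arrow hS hB).trans (ih hD hpost (hpost.hasType hS hD trivial))
  | all D ih =>
    have hpost := h.post_all hS renStable_true trivial hB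
    have hD := hS.body hB
    exact (EpsEq.teta happ).trans <| .tlam hB <|
      (h.epsEq_post_all hS hB).trans (ih hD hpost (hpost.hasType hS hD trivial))

end SaturatedApp

section Instance

variable {S I : Ty → Prop} {Γ : List Ty} {t : Tm} {B : Ty} {K : List (List Ty)}

theorem saturatedApp_varArgs (hS : RenStable S)
    (hK : ∀ A ∈ K.map (arrows · B), S A) (ht : HasType S I Γ t (.all (polynomial K))) :
    SaturatedApp S I ((K.map (arrows · B)).reverse ++ Γ) (t.ren (· + K.length)) B (varArgs K) := by
  have htK := ht.ren_add_length hS hK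
  rw [List.length_map] at htK
  have hvars := HasType.tmVars (I := I) (htK.ctx_mem hS)
  rw [List.length_map, List.forall₂_map_left_iff, List.forall₂_iff_zip] at hvars
  exact ⟨(map_dom_varArgs K).symm ▸ htK, List.forall_mem_map.2 fun _ hq => hvars.2 hq⟩

theorem hasType_atomTapp (hS : IsFragment S) (hI : RenStable I) (hIvar : ∀ i, I (.var i))
    (hB : S B) (hKB : S ((polynomial K).inst B)) (ht : HasType S I Γ t (.all (polynomial K))) :
    HasType S I Γ (atomTapp K t B) ((polynomial K).inst B) := by
  rw [polynomial_inst] at hKB ⊢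
  exact .lams hS <| (saturatedApp_varArgs hS.ren (hS.of_arrows hKB) ht).hasType_atomApps hS hI
    hIvar hB

theorem epsEq_atomTapp (hS : IsFragment S) (hB : S B) (hKB : S ((polynomial K).inst B))
    (ht : Typed S Γ t (.all (polynomial K))) :
    EpsEq S Γ (.tapp t B) (atomTapp K t B) ((polynomial K).inst B) := by
  have htB := HasType.tapp hB trivial hKB ht
  rw [polynomial_inst] at hKB htB ⊢
  refine .lams_of_apps_tmVars hS htB ?_
  have hsat := saturatedApp_varArgs hS.ren (hS.of_arrows hKB) ht
  rw [List.length_map, ← map_tm_varArgs]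
  exact hsat.epsEq_atomApps hS hB

end Instance

/-! ### The polynomial fragment -/

theorem Ty.Poly.ren : RenStable Ty.Poly := by
  intro ξ A hA
  induction hA generalizing ξ with
  | var i => exact .var (ξ i)
  | arrow _ _ ihA ihB => exact .arrow (ihA ξ) (ihB ξ)
  | @all K _ ih =>
    rw [Ty.ren, polynomial_ren]
    exact .all <| List.forall_mem_map.2 fun As hAs => List.forall_mem_map.2 fun A hA =>
      ih As hAs A hA ξ

theorem Ty.Poly.polynomial {K : List (List Ty)} (hK : ∀ As ∈ K, ∀ A ∈ As, A.Poly) :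
    (polynomial K).Poly :=
  arrows_mem .arrow (List.forall_mem_map.2 fun As hAs => arrows_mem .arrow
    (List.forall_mem_map.2 fun A hA => .ren _ A (hK As hAs A hA)) (.var 0)) (.var 0)

theorem isFragment_poly : IsFragment Ty.Poly where
  ren := Ty.Poly.ren
  var := .var
  arrow := .arrow
  dom | .arrow hA _ => hA
  cod | .arrow _ hB => hB
  body := by
    rintro _ @⟨⟩
    exact .polynomial ‹_›

end SystemF

theorem mainTheorem9_general {S : SystemF.Ty → Prop} (hS : SystemF.IsFragment S)
    (hpoly : ∀ A, S (.all A) → ∃ K, A = SystemF.polynomial K) {Γ : List SystemF.Ty}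
    {t : SystemF.Tm} {A : SystemF.Ty} (ht : SystemF.Typed S Γ t A) :
    ∃ t' : SystemF.Tm, SystemF.AtomTyped S Γ t' A ∧ SystemF.EpsEq S Γ t t' A := by
  induction ht with
  | var hΓ hi => exact ⟨_, .var hΓ hi, .refl (.var hΓ hi)⟩
  | lam hAB _ ih =>
    obtain ⟨t', ht', heq⟩ := ih
    exact ⟨_, .lam hAB ht', .lam hAB heq⟩
  | app hB _ _ iht ihu =>
    obtain ⟨t', ht', heqt⟩ := iht
    obtain ⟨u', hu', hequ⟩ := ihu
    exact ⟨_, .app hB ht' hu', .app hB heqt hequ⟩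
  | tlam hA _ ih =>
    obtain ⟨t', ht', heq⟩ := ih
    exact ⟨_, .tlam hA ht', .tlam hA heq⟩
  | tapp hB _ hAB ht ih =>
    obtain ⟨t', ht', heq⟩ := ih
    obtain ⟨K, rfl⟩ := hpoly _ ht.type_mem
    have hatom := SystemF.hasType_atomTapp hS SystemF.renStable_isVar (fun i => ⟨i, rfl⟩) hB hAB ht'
    exact ⟨_, hatom, (heq.tapp hB hAB).trans (SystemF.epsEq_atomTapp hS hB hAB ht'.typed)⟩

/-- Every typing judgement of the polynomial fragment has an epsilon-equivalent one in the atomic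
system. The equation already holds in the epsilon-theory of the polynomial fragment itself, hence in
that of every larger fragment. -/
theorem mainTheorem9 (Γ : List SystemF.Ty) (t : SystemF.Tm) (A : SystemF.Ty)
    (ht : SystemF.PolyTyped Γ t A) :
    ∃ t' : SystemF.Tm, SystemF.AtTyped Γ t' A ∧
      SystemF.EpsEq SystemF.Ty.Poly Γ t t' A := by
  obtain ⟨t', ht', heq⟩ := mainTheorem9_general SystemF.isFragment_poly
    (fun _ hA => by cases hA; exact ⟨_, rfl⟩) ht
  exact ⟨t', ht'.mono (fun _ _ => trivial) fun _ => id, heq⟩
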